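/- Let $G$ be a group. A \emph{connection set} in $G$ is a subset $S\subseteq G\setminus\{e\}$ with $S=S^{-1}$; for such $S$ (finite or infinite), the Cayley graph $\mathrm{Cay}(G;S)$ is the undirected graph with vertex set $G$ in which $x$ and $y$ are adjacent if and only if $x^{-1}y\in S$. The Cayley graph $\mathrm{Cay}(G;S)$ is a \emph{CI-graph} if, for every connection set $S'$ in $G$ such that $\mathrm{Cay}(G;S)$ and $\mathrm{Cay}(G;S')$ are isomorphic graphs, there is a group automorphism $\alpha$ of $G$ with $\alpha(S)=S'$. The group $G$ is a \emph{CI-group} if every Cayley graph on $G$ is a CI-graph. \textbf{Theorem.} No infinite abelian group is a CI-group. -/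

import Mathlib

/-- A connection set of an undirected, loopless Cayley graph on the group `G`: a set of
non-identity elements that is closed under inversion. -/
def IsConnectionSet {G : Type*} [Group G] (S : Set G) : Prop :=
  (1 : G) ∉ S ∧ S⁻¹ = S

/-- The Cayley graph `Cay(G; S)` is a CI-graph: whenever it is isomorphic, as a graph, to some
Cayley graph `Cay(G; S')` on the same group, there is a group automorphism of `G` carrying `S`
to `S'`. For a connection set `S`, `SimpleGraph.mulCayley S` joins `x` to `y` exactly when
`x⁻¹ * y ∈ S` (see `mulCayley_adj_iff_of_isConnectionSet`). -/
def IsCIGraph {G : Type*} [Group G] (S : Set G) : Prop :=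
  ∀ S' : Set G, IsConnectionSet S' →
    Nonempty (SimpleGraph.mulCayley S ≃g SimpleGraph.mulCayley S') →
      ∃ α : G ≃* G, α '' S = S'

/-- A group `G` is a CI-group if every Cayley graph on `G` is a CI-graph. -/
def IsCIGroup (G : Type*) [Group G] : Prop :=
  ∀ S : Set G, IsConnectionSet S → IsCIGraph S

theorem mulCayley_adj_iff_of_isConnectionSet {G : Type*} [Group G] {S : Set G}
    (hS : IsConnectionSet S) (x y : G) :
    (SimpleGraph.mulCayley S).Adj x y ↔ x⁻¹ * y ∈ S := by
  rw [SimpleGraph.mulCayley_adj']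
  constructor
  · rintro ⟨-, g, hg, h | h⟩
    · simpa [← h] using hg
    · have hg' : g⁻¹ ∈ S := by
        rw [← hS.2]
        simpa using hg
      simpa [h] using hg'
  · intro h
    refine ⟨?_, x⁻¹ * y, h, Or.inl (by simp)⟩
    rintro rfl
    exact hS.1 (by simpa using h)

/-! A Cayley graph whose connection set lies in a subgroup is a disjoint union of copies of a Cayley
graph of that subgroup, one per coset. Hence nonlinear isomorphisms between Cayley graphs of
subgroups extend to `G`, and the CI property turns them into automorphisms
(`exists_mulEquiv_of_subgroup`, `exists_endomorphism`).

This constrains an abelian CI-group in three ways. Cyclic subgroups: no element has infinite order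
or order divisible by `p ^ 6` (`not_mul_self_dvd_orderOf`). Elementary abelian subgroups: a shear by
monomials gives isomorphic graphs that no injective endomorphism relates once the rank is infinite,
so every `p`-torsion subgroup is finite (`not_injective_of_indicator`). Primes: `G` is now
countable, and if infinitely many primes occurred, two primary parts over disjoint infinite sets of
primes would be exchanged by an automorphism, which preserves orders (`finite_setOf_prime_orderOf`).
So `G` has bounded exponent and finite torsion, hence is finite. -/

/-! ### Extending isomorphisms from subgroups -/

theorem IsCIGroup.exists_mulEquiv_of_subgroup {G : Type*} [Group G] (hG : IsCIGroup G)
    {H K : Subgroup G} (q : G ⧸ H ≃ G ⧸ K) (φ : H ≃ K) {S S' : Set G}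
    (hS : IsConnectionSet S) (hS' : IsConnectionSet S')
    (hSH : S ⊆ H) (hSK : S' ⊆ K)
    (hφ : ∀ x y : H, (x : G)⁻¹ * y ∈ S ↔ (φ x : G)⁻¹ * φ y ∈ S') :
    ∃ α : G ≃* G, α '' S = S' := by
  have key : ∀ (L : Subgroup G) (T : Set G), T ⊆ L → ∀ x y : (G ⧸ L) × L,
      (x.1.out * x.2 : G)⁻¹ * (y.1.out * y.2) ∈ T ↔ x.1 = y.1 ∧ (x.2 : G)⁻¹ * y.2 ∈ T := by
    rintro L T hT ⟨a, x⟩ ⟨b, y⟩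
    constructor
    · intro h
      have hab : a = b := by
        have h' : a.out⁻¹ * b.out ∈ L := by
          have := L.mul_mem (L.mul_mem x.2 (hT h)) (L.inv_mem y.2)
          simpa [mul_assoc] using this
        rw [← QuotientGroup.eq] at h'
        simpa using h'
      subst hab
      exact ⟨rfl, by simpa [mul_assoc] using h⟩
    · rintro ⟨h1, h2⟩
      dsimp only at h1 h2 ⊢
      subst h1
      simpa [mul_assoc] using h2
  have bij : ∀ L : Subgroup G,
      Function.Bijective fun x : (G ⧸ L) × L => (x.1.out * x.2 : G) := by
    intro L
    constructor
    · rintro ⟨a, x⟩ ⟨b, y⟩ h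
      -- Equality of two elements is the case `T = {1}` of `key`.
      have h1 := (key L {1} (by simp [L.one_mem]) (a, x) (b, y)).1 (by
        dsimp only at h ⊢
        rw [h]; simp)
      obtain ⟨h1, h2⟩ := h1
      ext1
      · exact h1
      · exact Subtype.ext (inv_mul_eq_one.1 (by simpa using h2))
    · intro g
      refine ⟨(QuotientGroup.mk g, ⟨(QuotientGroup.mk g : G ⧸ L).out⁻¹ * g, ?_⟩), by simp⟩
      rw [← QuotientGroup.eq]
      simp
  let e (L : Subgroup G) : (G ⧸ L) × L ≃ G := Equiv.ofBijective _ (bij L)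
  refine hG S hS S' hS' ⟨⟨((e H).symm.trans (q.prodCongr φ)).trans (e K), ?_⟩⟩
  intro x y
  obtain ⟨x, rfl⟩ := (e H).surjective x
  obtain ⟨y, rfl⟩ := (e H).surjective y
  rw [mulCayley_adj_iff_of_isConnectionSet hS, mulCayley_adj_iff_of_isConnectionSet hS']
  simp only [Equiv.trans_apply, Equiv.symm_apply_apply]
  refine (key K S' hSK _ _).trans (Iff.trans ?_ (key H S hSH x y).symm)
  simp [hφ]

/-- In a CI-group, two isomorphic Cayley graphs of an embedded group `A`, the first of them
connected, are related by an injective endomorphism of `A`. -/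
theorem IsCIGroup.exists_endomorphism {G A : Type*} [Group G] [AddGroup A] (hG : IsCIGroup G)
    (f : Multiplicative A →* G) (hf : Function.Injective f) {S S' : Set A}
    (h0 : (0 : A) ∉ S) (hneg : ∀ x ∈ S, -x ∈ S) (h0' : (0 : A) ∉ S') (hneg' : ∀ x ∈ S', -x ∈ S')
    (hgen : AddSubgroup.closure S = ⊤) (φ : A ≃ A)
    (hφ : ∀ x y : A, -x + y ∈ S ↔ -φ x + φ y ∈ S') :
    ∃ β : A →+ A, Function.Injective β ∧ β '' S = S' := by
  let g : A → G := fun a => f (Multiplicative.ofAdd a)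
  have hg : Function.Injective g := fun a b h => hf h
  have g0 : g 0 = 1 := map_one f
  have gneg (a : A) : g (-a) = (g a)⁻¹ := map_inv f _
  have gadd (a b : A) : g (a + b) = g a * g b := map_mul f _ _
  have conn : ∀ T : Set A, (0 : A) ∉ T → (∀ x ∈ T, -x ∈ T) → IsConnectionSet (g '' T) := by
    intro T h1 h2
    constructor
    · rintro ⟨a, ha, h⟩
      rw [← g0] at h
      exact h1 (hg h ▸ ha)
    · ext x
      constructor
      · rintro ⟨a, ha, h⟩
        exact ⟨-a, h2 a ha, by rw [gneg, h, inv_inv]⟩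
      · rintro ⟨a, ha, rfl⟩
        exact ⟨-a, h2 a ha, by rw [gneg]⟩
  have eq : ∀ y : f.range, ∃ a : A, g a = y := by
    rintro ⟨_, a, rfl⟩
    exact ⟨a.toAdd, rfl⟩
  let e : A ≃ f.range := Equiv.ofBijective (fun a => ⟨g a, Multiplicative.ofAdd a, rfl⟩)
    ⟨fun a b h => hg (congrArg Subtype.val h), fun y => (eq y).imp fun a ha => Subtype.ext ha⟩
  obtain ⟨α, hα⟩ := hG.exists_mulEquiv_of_subgroup (Equiv.refl (G ⧸ f.range))
    ((e.symm.trans φ).trans e) (conn S h0 hneg) (conn S' h0' hneg')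
    (by rintro _ ⟨a, -, rfl⟩; exact ⟨_, rfl⟩) (by rintro _ ⟨a, -, rfl⟩; exact ⟨_, rfl⟩) (by
      intro x y
      obtain ⟨x, rfl⟩ := e.surjective x
      obtain ⟨y, rfl⟩ := e.surjective y
      have he (a : A) : (e a : G) = g a := rfl
      simp only [Equiv.trans_apply, Equiv.symm_apply_apply, he, ← gneg, ← gadd]
      rw [hg.mem_set_image, hg.mem_set_image, hφ])
  -- `α` maps the generating set into the image of `A`, hence all of that image.
  have hrange : ∀ a : A, ∃ b : A, g b = α (g a) := by
    intro a
    have ha : a ∈ AddSubgroup.closure S := hgen ▸ AddSubgroup.mem_top a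
    induction ha using AddSubgroup.closure_induction with
    | mem x hx =>
      have : α (g x) ∈ g '' S' := hα ▸ ⟨g x, ⟨x, hx, rfl⟩, rfl⟩
      obtain ⟨b, -, hb⟩ := this
      exact ⟨b, hb⟩
    | zero => exact ⟨0, by rw [g0, map_one]⟩
    | add x y _ _ hx hy =>
      obtain ⟨b, hb⟩ := hx
      obtain ⟨c, hc⟩ := hy
      exact ⟨b + c, by rw [gadd, gadd, map_mul, hb, hc]⟩
    | neg x _ hx =>
      obtain ⟨b, hb⟩ := hx
      exact ⟨-b, by rw [gneg, gneg, map_inv, hb]⟩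
  choose β hβ using hrange
  refine ⟨⟨⟨β, hg (by rw [hβ, g0, map_one])⟩, fun x y => hg ?_⟩, ?_, ?_⟩
  · rw [hβ, gadd, gadd, map_mul]
    simp [hβ]
  · intro x y h
    apply hg
    apply α.injective
    rw [← hβ, ← hβ]
    exact congrArg g h
  · apply hg.image_injective
    rw [← hα, Set.image_image, Set.image_image]
    exact Set.image_congr fun a _ => hβ a

/-! ### Cyclic subgroups -/

theorem exists_injective_multiplicative_zmod_orderOf {G : Type*} [Group G] (g : G) :
    ∃ f : Multiplicative (ZMod (orderOf g)) →* G, Function.Injective f := by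
  let e : ZMod (orderOf g) →+ Additive G :=
    ZMod.lift (orderOf g) ⟨zmultiplesHom (Additive G) (Additive.ofMul g), by
      simp only [zmultiplesHom_apply, natCast_zsmul]
      rw [← ofMul_pow, pow_orderOf_eq_one, ofMul_one]⟩
  refine ⟨AddMonoidHom.toMultiplicativeLeft e, ?_⟩
  have he : Function.Injective e := by
    refine (ZMod.lift_injective _).2 fun i hi => ?_
    rw [ZMod.intCast_zmod_eq_zero_iff_dvd, orderOf_dvd_iff_zpow_eq_one]
    simpa [← ofMul_zpow] using hi
  exact fun a b h => he h

/-- A CI-group has no element whose order is `0` or a multiple of `m ^ 2`, for `m` such that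
`ℤ/m` has a unit other than `±1`. -/
theorem IsCIGroup.not_mul_self_dvd_orderOf {G : Type*} [Group G] (hG : IsCIGroup G) {m : ℕ}
    (k : (ZMod m)ˣ) (hk : k ≠ 1) (hk' : k ≠ -1) (g : G) : ¬ m * m ∣ orderOf g := by
  intro hdvd
  obtain ⟨f, hf⟩ := exists_injective_multiplicative_zmod_orderOf g
  generalize orderOf g = n at *
  have hm0 : m ≠ 0 := by
    rintro rfl
    rcases Int.units_eq_one_or k with h | h
    · exact hk h
    · exact hk' h
  have hm1 : m ≠ 1 := by
    rintro rfl
    exact hk (Subsingleton.elim _ _)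
  have hmn : m ∣ n := (Dvd.intro _ rfl).trans hdvd
  have : Nontrivial (ZMod m) := ZMod.nontrivial_iff.2 hm1
  let c : ZMod n →+* ZMod m := ZMod.castHom hmn (ZMod m)
  have hc : Function.Surjective c := ZMod.castHom_surjective hmn
  choose s hs using hc
  have cm : c (m : ZMod n) = 0 := by simp
  have hmne : (m : ZMod n) ≠ 0 := by
    intro h
    rw [ZMod.natCast_eq_zero_iff] at h
    have := Nat.le_of_dvd (Nat.pos_of_ne_zero hm0) (hdvd.trans h)
    have h2 : 2 ≤ m := by omega
    nlinarith
  -- The cosets over `±u` will force `β 1 ≡ ±k` mod `m`, while the points `±m` in the kernel of `c`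
  -- will force `β 1 ≡ ±1`.
  let T (u : (ZMod m)ˣ) : Set (ZMod n) := {x | c x = u ∨ c x = -u ∨ x = m ∨ x = -m}
  have T0 (u) : (0 : ZMod n) ∉ T u := by
    rintro (h | h | h | h)
    · exact u.ne_zero (by simpa using h.symm)
    · exact u.ne_zero (by simpa using h.symm)
    · exact hmne h.symm
    · exact hmne (by simpa using h.symm)
  have Tneg (u) : ∀ x ∈ T u, -x ∈ T u := by
    rintro x (h | h | h | h)
    · exact Or.inr (Or.inl (by rw [map_neg, h]))
    · exact Or.inl (by rw [map_neg, h, neg_neg])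
    · exact Or.inr (Or.inr (Or.inr (by rw [h])))
    · exact Or.inr (Or.inr (Or.inl (by rw [h, neg_neg])))
  -- The cosets of the kernel of `c` are permuted by multiplication by `k`, each being moved by a
  -- translation, so differences within a coset are kept.
  let φ : ZMod n ≃ ZMod n :=
    { toFun := fun x => x - s (c x) + s (k * c x)
      invFun := fun x => x - s (c x) + s ((k⁻¹ : (ZMod m)ˣ) * c x)
      left_inv := fun x => by simp [hs]
      right_inv := fun x => by simp [hs] }
  have cφ (x) : c (φ x) = k * c x := by simp [φ, hs]
  have hφ : ∀ x y : ZMod n, -x + y ∈ T 1 ↔ -φ x + φ y ∈ T k := by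
    intro x y
    have h1 : c (-φ x + φ y) = k * c (-x + y) := by
      rw [map_add, map_neg, cφ, cφ, map_add, map_neg]; ring
    have h2 (hxy : c (-x + y) = 0) : -φ x + φ y = -x + y := by
      have : c x = c y := by
        rw [map_add, map_neg] at hxy
        exact neg_add_eq_zero.1 hxy
      simp only [φ, Equiv.coe_fn_mk, this]; ring
    have h3 : ∀ z : ZMod n, c z = 0 → (-x + y = z ↔ -φ x + φ y = z) := by
      intro z hz
      constructor
      · intro h
        rw [h2 (by rw [h, hz]), h]
      · intro h
        have h4 : c (-x + y) = 0 := by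
          rw [h, hz] at h1
          exact (k.mul_right_eq_zero).1 h1.symm
        rw [← h2 h4, h]
    simp only [T, Set.mem_ofPred_eq, h1]
    rw [h3 m cm, h3 (-m) (by rw [map_neg, cm, neg_zero])]
    have e1 : (k * c (-x + y) = k) ↔ c (-x + y) = (1 : (ZMod m)ˣ) := by
      rw [Units.val_one]
      nth_rewrite 2 [← mul_one (k : ZMod m)]
      exact k.mul_right_inj
    have e2 : (k * c (-x + y) = -k) ↔ c (-x + y) = -(1 : (ZMod m)ˣ) := by
      rw [Units.val_one, ← mul_neg_one (k : ZMod m)]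
      exact k.mul_right_inj
    rw [e1, e2]
  have hgen : AddSubgroup.closure (T 1) = ⊤ := by
    rw [eq_top_iff]
    rintro x -
    obtain ⟨i, rfl⟩ := ZMod.intCast_surjective x
    have h1 : (1 : ZMod n) ∈ AddSubgroup.closure (T 1) :=
      AddSubgroup.subset_closure (Or.inl (by simp))
    simpa using AddSubgroup.zsmul_mem _ h1 i
  obtain ⟨β, -, hβS⟩ := hG.exists_endomorphism f hf (T0 1) (Tneg 1) (T0 k) (Tneg k) hgen φ hφ
  have hβ (x : ZMod n) : β x = x * β 1 := by
    obtain ⟨i, rfl⟩ := ZMod.intCast_surjective x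
    have := map_zsmul β i 1
    simpa using this
  have hr0 : c (β 1) ≠ 0 := by
    intro h
    have : s k ∈ β '' T 1 := hβS ▸ Or.inl (hs k)
    obtain ⟨x, -, hx⟩ := this
    have := congrArg c hx
    rw [hβ, map_mul, h, mul_zero, hs] at this
    exact k.ne_zero this.symm
  have hr : c (β 1) = k ∨ c (β 1) = -k := by
    have h1 : β 1 ∈ T k := hβS ▸ ⟨1, Or.inl (by simp), rfl⟩
    rcases h1 with h | h | h | h
    · exact Or.inl h
    · exact Or.inr h
    · exact absurd (by rw [h, cm]) hr0
    · exact absurd (by rw [h, map_neg, cm, neg_zero]) hr0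
  -- Here `m * m ∣ n` is used: cancelling `m` still leaves a congruence mod `m`.
  have hdiv : ∀ i : ℤ, (m : ZMod n) * β 1 = m * i → c (β 1) = i := by
    intro i hi
    obtain ⟨j, hj⟩ := ZMod.intCast_surjective (β 1)
    rw [← hj] at hi ⊢
    have h1 : ((m * (j - i) : ℤ) : ZMod n) = 0 := by
      push_cast
      rw [mul_sub, hi, sub_self]
    rw [ZMod.intCast_zmod_eq_zero_iff_dvd] at h1
    have h2 : (m : ℤ) * m ∣ m * (j - i) := (by exact_mod_cast hdvd : (m : ℤ) * m ∣ n).trans h1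
    have h3 : (m : ℤ) ∣ j - i := Int.dvd_of_mul_dvd_mul_left (by exact_mod_cast hm0) h2
    rw [map_intCast, ← sub_eq_zero, ← Int.cast_sub]
    exact (ZMod.intCast_zmod_eq_zero_iff_dvd _ _).2 h3
  have hr' : c (β 1) = 1 ∨ c (β 1) = -1 := by
    have h1 : β m ∈ T k := hβS ▸ ⟨m, Or.inr (Or.inr (Or.inl rfl)), rfl⟩
    have h2 : c (β m) = 0 := by rw [hβ, map_mul, cm, zero_mul]
    rcases h1 with h | h | h | h
    · exact absurd (h.symm.trans h2) k.ne_zero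
    · exact absurd (neg_eq_zero.1 (h.symm.trans h2)) k.ne_zero
    · exact Or.inl (by simpa using hdiv 1 (by rw [← hβ, h]; simp))
    · exact Or.inr (by simpa using hdiv (-1) (by rw [← hβ, h]; simp))
  have k1 : (k : ZMod m) ≠ 1 := fun h => hk (Units.ext h)
  have k2 : (k : ZMod m) ≠ -1 := fun h => hk' (Units.ext h)
  rcases hr with h | h <;> rcases hr' with h' | h' <;> rw [h] at h'
  · exact k1 h'
  · exact k2 h'
  · exact k2 (neg_eq_iff_eq_neg.1 h')
  · exact k1 (neg_inj.1 h')

/-- Take `m = p ^ 3` and the unit `1 + p`. The exponent 3 serves `p = 2`, since `3 = -1` mod 4. -/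
theorem IsCIGroup.not_prime_pow_six_dvd_orderOf {G : Type*} [Group G] (hG : IsCIGroup G)
    {p : ℕ} (hp : p.Prime) (g : G) : ¬ p ^ 6 ∣ orderOf g := by
  have hcop : Nat.Coprime (1 + p) (p ^ 3) :=
    Nat.Coprime.pow_right 3 (by simp)
  have hp2 := hp.two_le
  have hlt : p + 2 < p ^ 3 := by nlinarith [Nat.mul_le_mul hp2 hp2, pow_succ p 2, pow_two p]
  have h := hG.not_mul_self_dvd_orderOf (ZMod.unitOfCoprime (1 + p) hcop) ?_ ?_ g
  · rwa [← pow_add] at h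
  · intro h
    have h1 := congrArg Units.val h
    rw [ZMod.coe_unitOfCoprime, Units.val_one, Nat.cast_add, Nat.cast_one, add_eq_left,
      ZMod.natCast_eq_zero_iff] at h1
    have := Nat.le_of_dvd hp.pos h1
    omega
  · intro h
    have h1 := congrArg Units.val h
    rw [ZMod.coe_unitOfCoprime, Units.val_neg, Units.val_one, eq_neg_iff_add_eq_zero] at h1
    have h2 : ((p + 2 : ℕ) : ZMod (p ^ 3)) = 0 := by
      rw [← h1]; push_cast; ring
    rw [ZMod.natCast_eq_zero_iff] at h2
    have := Nat.le_of_dvd (by omega) h2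
    omega

/-! ### Sums of monomials over subsets, and indicators -/

section Indicator

variable {α R : Type*} [Fintype α] [DecidableEq α] [CommRing R]

/-- Expand the product: if `t` is the set of factors contributing the indicator, only `t ⊆ J`
survives, and `M = I ∪ t`. -/
theorem prod_compl_add_indicator (u : α → R) {I J : Finset α} (h : I ⊆ J) :
    ∏ i ∈ Iᶜ, (u i + if i ∈ J then 1 else 0) = ∑ M ∈ J.powerset with I ⊆ M, ∏ i ∈ Mᶜ, u i := by
  simp only [add_comm (u _)]
  rw [Finset.prod_add]
  have h1 : ∀ t ∈ Iᶜ.powerset, ((∏ i ∈ t, if i ∈ J then (1 : R) else 0) * ∏ i ∈ Iᶜ \ t, u i) =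
      if t ⊆ J then ∏ i ∈ (I ∪ t)ᶜ, u i else 0 := by
    intro t _
    rw [Finset.prod_ite_zero, Finset.prod_const_one, Finset.compl_union,
      ← Finset.sdiff_eq_inter_compl]
    simp [Finset.subset_iff]
  rw [Finset.sum_congr rfl h1, ← Finset.sum_filter]
  refine Finset.sum_nbij' (fun t => I ∪ t) (fun M => M \ I) ?_ ?_ ?_ ?_ ?_
  · intro t ht
    simp only [Finset.mem_filter, Finset.mem_powerset] at ht ⊢
    exact ⟨Finset.union_subset h ht.2, Finset.subset_union_left⟩
  · intro M hM
    simp only [Finset.mem_filter, Finset.mem_powerset] at hM ⊢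
    refine ⟨?_, Finset.sdiff_subset.trans hM.1⟩
    intro i hi
    simp only [Finset.mem_sdiff] at hi
    simpa using hi.2
  · intro t ht
    simp only [Finset.mem_filter, Finset.mem_powerset] at ht
    exact Finset.union_sdiff_cancel_left (disjoint_compl_right.mono_right ht.1)
  · intro M hM
    simp only [Finset.mem_filter, Finset.mem_powerset] at hM
    exact Finset.union_sdiff_of_subset hM.2
  · intro t _
    rfl

theorem sum_powersetCard_prod_compl_add_indicator (u : α → R) (q : ℕ) (J : Finset α) :
    ∑ I ∈ J.powersetCard q, ∏ i ∈ Iᶜ, (u i + if i ∈ J then 1 else 0) =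
      ∑ M ∈ J.powerset, (M.card.choose q : R) * ∏ i ∈ Mᶜ, u i := by
  have h1 : ∀ I ∈ J.powersetCard q, ∏ i ∈ Iᶜ, (u i + if i ∈ J then 1 else 0) =
      ∑ M ∈ J.powerset with I ⊆ M, ∏ i ∈ Mᶜ, u i := fun I hI =>
    prod_compl_add_indicator u (Finset.mem_powersetCard.1 hI).1
  rw [Finset.sum_congr rfl h1,
    Finset.sum_comm' (s' := fun M => M.powersetCard q) (t' := J.powerset)]
  · refine Finset.sum_congr rfl fun M _ => ?_
    rw [Finset.sum_const, Finset.card_powersetCard, nsmul_eq_mul]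
  · intro I M
    simp only [Finset.mem_powersetCard, Finset.mem_filter, Finset.mem_powerset]
    constructor
    · rintro ⟨⟨-, h2⟩, h3, h4⟩
      exact ⟨⟨h4, h2⟩, h3⟩
    · rintro ⟨⟨h4, h2⟩, h3⟩
      exact ⟨⟨h4.trans h3, h2⟩, h3, h4⟩

/-- By Lucas, `m = p + r` with `r < p` gives `r.choose (p - 1)`, which vanishes unless `r = p - 1`.
-/
theorem cast_choose_pred_prime {p : ℕ} [Fact p.Prime] [CharP R p] {m : ℕ} (hm : m ≤ 2 * p - 1) :
    (m.choose (p - 1) : R) = if m = p - 1 ∨ m = 2 * p - 1 then 1 else 0 := by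
  have hp := (Fact.out : p.Prime).two_le
  rcases lt_trichotomy m (p - 1) with h | h | h
  · rw [Nat.choose_eq_zero_of_lt h, if_neg (by omega), Nat.cast_zero]
  · rw [h, Nat.choose_self, if_pos (Or.inl rfl), Nat.cast_one]
  · obtain ⟨r, rfl⟩ := Nat.exists_eq_add_of_le (show p ≤ m by omega)
    have h1 := Choose.choose_modEq_choose_mod_mul_choose_div_nat (n := p + r) (k := p - 1) (p := p)
    rw [Nat.add_mod_left, Nat.mod_eq_of_lt (show r < p by omega),
      Nat.mod_eq_of_lt (show p - 1 < p by omega), Nat.div_eq_of_lt (show p - 1 < p by omega),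
      Nat.choose_zero_right, mul_one] at h1
    rw [(CharP.cast_eq_iff_mod_eq R p).2 h1]
    rcases eq_or_ne r (p - 1) with hr | hr
    · rw [hr, Nat.choose_self, if_pos (by omega), Nat.cast_one]
    · rw [Nat.choose_eq_zero_of_lt (by omega), if_neg (by omega), Nat.cast_zero]

/-- The sum over `I ⊆ J`, `|I| = p - 1`, of the monomials `∏ i ∉ I, u i` changes by a constant
when `u` is translated by the indicator of `J`. -/
theorem sum_powersetCard_prod_compl_translate {p : ℕ} [Fact p.Prime] [CharP R p]
    (hα : Fintype.card α = 2 * p - 1) (u : α → R) (J : Finset α) :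
    ∑ I ∈ J.powersetCard (p - 1), ∏ i ∈ Iᶜ, (u i + if i ∈ J then 1 else 0) =
      (∑ I ∈ J.powersetCard (p - 1), ∏ i ∈ Iᶜ, u i) + if J = Finset.univ then 1 else 0 := by
  have hp := (Fact.out : p.Prime).two_le
  rw [sum_powersetCard_prod_compl_add_indicator]
  have h1 : ∀ M ∈ J.powerset, (M.card.choose (p - 1) : R) * ∏ i ∈ Mᶜ, u i =
      (if M.card = p - 1 then ∏ i ∈ Mᶜ, u i else 0) + if M = Finset.univ then 1 else 0 := by
    intro M _
    rw [cast_choose_pred_prime (hα ▸ M.card_le_univ)]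
    simp only [← hα, Finset.card_eq_iff_eq_univ]
    by_cases hM : M = Finset.univ
    · subst hM
      rw [if_pos (Or.inr rfl), if_neg (by rw [Finset.card_univ]; omega), if_pos rfl]
      simp
    · simp [hM]
  rw [Finset.sum_congr rfl h1, Finset.sum_add_distrib, ← Finset.sum_filter,
    ← Finset.powersetCard_eq_filter]
  congr 1
  rw [Finset.sum_ite_eq']
  simp [Finset.univ_subset_iff]

theorem alternating_sum_filter_superset {K : Finset α} (hK : K ≠ Finset.univ) :
    ∑ J : Finset α with K ⊆ J, (-1 : R) ^ J.card = 0 := by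
  have h1 : ∑ J : Finset α with K ⊆ J, (-1 : R) ^ J.card =
      ∑ t ∈ Kᶜ.powerset, (-1 : R) ^ (K.card + t.card) := by
    refine Finset.sum_nbij' (fun J => J \ K) (fun t => K ∪ t) ?_ ?_ ?_ ?_ ?_
    · intro J _
      simp only [Finset.mem_powerset]
      intro i hi
      simpa using (Finset.mem_sdiff.1 hi).2
    · intro t _
      simp
    · intro J hJ
      exact Finset.union_sdiff_of_subset (Finset.mem_filter.1 hJ).2
    · intro t ht
      exact Finset.union_sdiff_cancel_left (disjoint_compl_right.mono_right (Finset.mem_powerset.1 ht))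
    · intro J hJ
      rw [add_comm, Finset.card_sdiff_add_card_eq_card (Finset.mem_filter.1 hJ).2]
  have h2 := Finset.sum_powerset_neg_one_pow_card_of_nonempty (x := Kᶜ) (by
    rwa [Finset.nonempty_iff_ne_empty, Ne, Finset.compl_eq_empty_iff])
  simp only [pow_add] at h1
  rw [h1, ← Finset.mul_sum]
  have h3 := congrArg (Int.cast : ℤ → R) h2
  push_cast at h3
  rw [h3, mul_zero]

/-- No additive map `ℓ` satisfies `∑ I ⊆ J, |I| = q, ℓ(1_J) I = [J = univ]` for all nonempty `J`. -/
theorem not_forall_sum_powersetCard_indicator [Nontrivial R] {q : ℕ} (hq0 : q ≠ 0)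
    (hq : q + 1 < Fintype.card α) (l : (α → R) →+ (Finset α → R)) :
    ¬ ∀ J : Finset α, J.Nonempty →
      ∑ I ∈ J.powersetCard q, l (fun i => if i ∈ J then 1 else 0) I =
        if J = Finset.univ then 1 else 0 := by
  intro h
  have h0 : ∀ J : Finset α, ∑ I ∈ J.powersetCard q, l (fun i => if i ∈ J then 1 else 0) I =
        if J = Finset.univ then 1 else 0 := by
    intro J
    rcases J.eq_empty_or_nonempty with rfl | hJ
    · have : (∅ : Finset α) ≠ Finset.univ := by
        intro h'
        have := congrArg Finset.card h'
        rw [Finset.card_empty, Finset.card_univ] at this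
        omega
      rw [if_neg this, Finset.powersetCard_eq_empty.2 (by simpa using Nat.pos_of_ne_zero hq0),
        Finset.sum_empty]
    · exact h J hJ
  have hl : ∀ J I : Finset α, l (fun i => if i ∈ J then 1 else 0) I =
      ∑ j ∈ J, l (Pi.single j 1) I := by
    intro J I
    have : (fun i => if i ∈ J then (1 : R) else 0) = ∑ j ∈ J, Pi.single j 1 := by
      ext i
      simp [Finset.sum_apply, Pi.single_apply]
    rw [this, map_sum, Finset.sum_apply]
  have h1 : ∑ J : Finset α, (-1 : R) ^ J.card *
      ∑ I ∈ J.powersetCard q, l (fun i => if i ∈ J then 1 else 0) I =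
        (-1) ^ Fintype.card α := by
    simp [h0, Finset.card_univ]
  -- By additivity this is a sum over pairs `(I, j)`, each weighted by the alternating sum over `J ⊇
  -- I ∪ {j}`; that union has at most `q + 1` elements, so it is not everything.
  have h2 : ∑ J : Finset α, (-1 : R) ^ J.card *
      ∑ I ∈ J.powersetCard q, l (fun i => if i ∈ J then 1 else 0) I = 0 := by
    simp only [hl, Finset.mul_sum]
    rw [Finset.sum_comm' (s' := fun I : Finset α => {J : Finset α | I ⊆ J})
      (t' := Finset.univ.powersetCard q)]
    · refine Finset.sum_eq_zero fun I hI => ?_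
      rw [Finset.sum_comm' (s' := fun j : α => {J : Finset α | I ∪ {j} ⊆ J}) (t' := Finset.univ)]
      · refine Finset.sum_eq_zero fun j _ => ?_
        rw [← Finset.sum_mul, alternating_sum_filter_superset, zero_mul]
        intro h'
        have h3 := Finset.card_union_le I {j}
        rw [h', Finset.card_univ, (Finset.mem_powersetCard.1 hI).2, Finset.card_singleton] at h3
        omega
      · intro J j
        simp [Finset.insert_subset_iff, and_comm]
    · intro J I
      simp [Finset.mem_powersetCard]
  rw [h1] at h2
  exact ((isUnit_one.neg.pow _).ne_zero) h2

end Indicator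

/-! ### Elementary abelian subgroups of infinite rank -/

/-- For `x ∈ X` outside `Y`, the translate of the infinite set `X ⊓ Y` by `x` would avoid `Y` and so
lie in `F`. -/
theorem AddSubgroup.le_of_subset_union_finite {A : Type*} [AddGroup A] {X Y : AddSubgroup A}
    {F : Set A} (hX : (X : Set A).Infinite) (hF : F.Finite) (h : (X : Set A) ⊆ Y ∪ F) :
    X ≤ Y := by
  intro x hx
  by_contra hxY
  have hinf : ((X ⊓ Y : AddSubgroup A) : Set A).Infinite := by
    intro hfin
    refine hX ((hfin.union hF).subset fun z hz => ?_)
    rcases h hz with h1 | h1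
    · exact Or.inl ⟨hz, h1⟩
    · exact Or.inr h1
  refine hinf.image (f := fun z => x + z) (add_right_injective x).injOn (hF.subset ?_)
  rintro _ ⟨z, hz, rfl⟩
  rcases h (X.add_mem hx hz.1) with h1 | h1
  · exact absurd ((Y.add_mem_cancel_right hz.2).1 h1) hxY
  · exact h1

section Elementary

variable {α R E : Type*} [DecidableEq α] [CommRing R]

/-- The indicator function of a finite set. -/
def finsetIndicator (R : Type*) [CommRing R] (J : Finset α) : α → R :=
  fun i => if i ∈ J then 1 else 0

theorem finsetIndicator_ne_zero [Nontrivial R] {J : Finset α} (hJ : J.Nonempty) :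
    finsetIndicator R J ≠ 0 := by
  obtain ⟨i, hi⟩ := hJ
  intro h
  simpa [finsetIndicator, hi] using congrFun h i

theorem finsetIndicator_injective [Nontrivial R] :
    Function.Injective (finsetIndicator R : Finset α → α → R) := by
  intro J K h
  ext i
  have := congrFun h i
  by_cases h1 : i ∈ J <;> by_cases h2 : i ∈ K <;> simp_all [finsetIndicator]

variable [Fintype α] [AddCommGroup E]

/-- The elements of `(α → R) × (Finset α → R) × E` lying over the indicator of `J`, with vanishing
last component, on whose middle component the sum over the `q`-subsets of `J` is prescribed: it is
`c` if `J` is everything and `0` otherwise. -/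
def indicatorFiber (α E : Type*) {R : Type*} [Fintype α] [DecidableEq α] [CommRing R]
    [AddCommGroup E] (q : ℕ) (c : R) (J : Finset α) : Set ((α → R) × (Finset α → R) × E) :=
  {x | x.1 = finsetIndicator R J ∧
    ∑ I ∈ J.powersetCard q, x.2.1 I = (if J = Finset.univ then c else 0) ∧ x.2.2 = 0}

/-- All nonzero elements with vanishing first component, and the elements over `±` indicators. -/
def indicatorConnectionSet (α E : Type*) {R : Type*} [Fintype α] [DecidableEq α] [CommRing R]
    [AddCommGroup E] (q : ℕ) (c : R) : Set ((α → R) × (Finset α → R) × E) :=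
  {x | (x.1 = 0 ∧ x ≠ 0) ∨ (∃ J : Finset α, J.Nonempty ∧ x ∈ indicatorFiber α E q c J) ∨
    ∃ J : Finset α, J.Nonempty ∧ -x ∈ indicatorFiber α E q c J}

variable {q : ℕ} {c : R}

theorem zero_notMem_indicatorConnectionSet [Nontrivial R] :
    0 ∉ indicatorConnectionSet α E q c := by
  rintro (h | ⟨J, hJ, h⟩ | ⟨J, hJ, h⟩)
  · exact h.2 rfl
  · exact finsetIndicator_ne_zero hJ h.1.symm
  · exact finsetIndicator_ne_zero (R := R) hJ (by rw [← h.1]; simp)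

theorem neg_mem_indicatorConnectionSet {x : (α → R) × (Finset α → R) × E}
    (hx : x ∈ indicatorConnectionSet α E q c) : -x ∈ indicatorConnectionSet α E q c := by
  rcases hx with h | h | h
  · exact Or.inl ⟨by simp [h.1], neg_ne_zero.2 h.2⟩
  · exact Or.inr (Or.inr (by simpa using h))
  · exact Or.inr (Or.inl h)

theorem snd_snd_eq_zero_of_mem_indicatorConnectionSet {x : (α → R) × (Finset α → R) × E}
    (hx : x ∈ indicatorConnectionSet α E q c) (h0 : x.1 ≠ 0) : x.2.2 = 0 := by
  rcases hx with h | ⟨J, -, h⟩ | ⟨J, -, h⟩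
  · exact absurd h.1 h0
  · exact h.2.2
  · exact neg_eq_zero.1 h.2.2

/-- For `c = 0` the fiber conditions are homogeneous, so a zero middle component satisfies them. -/
theorem mk_fst_zero_mem_indicatorConnectionSet {x : (α → R) × (Finset α → R) × E}
    (hx : x ∈ indicatorConnectionSet α E q (0 : R)) (h0 : x.1 ≠ 0) :
    (x.1, 0, 0) ∈ indicatorConnectionSet α E q (0 : R) := by
  rcases hx with h | ⟨J, hJ, h⟩ | ⟨J, hJ, h⟩
  · exact absurd h.1 h0
  · exact Or.inr (Or.inl ⟨J, hJ, h.1, by simp, rfl⟩)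
  · exact Or.inr (Or.inr ⟨J, hJ, h.1, by simp, by simp⟩)

theorem sum_powersetCard_of_mem_indicatorConnectionSet [Nontrivial R]
    {x : (α → R) × (Finset α → R) × E} (hx : x ∈ indicatorConnectionSet α E q c)
    {J : Finset α} (hJ : J.Nonempty) (hxJ : x.1 = finsetIndicator R J) :
    ∑ I ∈ J.powersetCard q, x.2.1 I = if J = Finset.univ then c else 0 := by
  rcases hx with h | ⟨K, hK, h⟩ | ⟨K, hK, h⟩
  · exact absurd (hxJ.symm.trans h.1) (finsetIndicator_ne_zero hJ)
  · obtain rfl := finsetIndicator_injective (hxJ.symm.trans h.1)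
    exact h.2.1
  · have h1 : -finsetIndicator R J = finsetIndicator R K := by rw [← hxJ]; exact h.1
    -- An indicator equals minus a nonempty one only in characteristic 2, where signs do not matter.
    have hneg : (-1 : R) = 1 := by
      obtain ⟨i, hi⟩ := hK
      have h2 := congrFun h1 i
      by_cases h3 : i ∈ J
      · simpa [finsetIndicator, hi, h3] using h2
      · simp [finsetIndicator, hi, h3] at h2
    have hneg' (r : R) : -r = r := by rw [← neg_one_mul, hneg, one_mul]
    obtain rfl : J = K := finsetIndicator_injective (R := R) (by
      rw [← h1]; ext i; simp [hneg'])
    have h2 := h.2.1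
    simpa [hneg'] using h2

theorem closure_indicatorConnectionSet {p : ℕ} [NeZero p] :
    AddSubgroup.closure (indicatorConnectionSet α E q (0 : ZMod p)) = ⊤ := by
  rw [eq_top_iff]
  rintro ⟨u, v⟩ -
  have h1 : ((0, v) : (α → ZMod p) × (Finset α → ZMod p) × E) ∈
      AddSubgroup.closure (indicatorConnectionSet α E q (0 : ZMod p)) := by
    by_cases hv : v = 0
    · subst hv
      exact AddSubgroup.zero_mem _
    · exact AddSubgroup.subset_closure (Or.inl ⟨rfl, fun h => hv (congrArg Prod.snd h)⟩)
  have h2 : AddMonoidHom.inl (α → ZMod p) ((Finset α → ZMod p) × E) u ∈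
      AddSubgroup.closure (indicatorConnectionSet α E q (0 : ZMod p)) := by
    have hu : u = ∑ i, (u i).val • finsetIndicator (ZMod p) {i} := by
      ext j
      have h (i : α) : ((u i).val • finsetIndicator (ZMod p) {i}) j = if j = i then u i else 0 := by
        rw [Pi.smul_apply, nsmul_eq_mul, ZMod.natCast_zmod_val]
        simp [finsetIndicator]
      simp [Finset.sum_apply, h, -nsmul_eq_mul]
    rw [hu, map_sum]
    refine AddSubgroup.sum_mem _ fun i _ => ?_
    rw [map_nsmul]
    refine AddSubgroup.nsmul_mem _ (AddSubgroup.subset_closure ?_) _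
    exact Or.inr (Or.inl ⟨{i}, by simp, rfl, by simp, rfl⟩)
  simpa using AddSubgroup.add_mem _ h2 h1

/-- The shear of `(α → R) × (Finset α → R) × E` by complementary monomials. -/
def monomialShear (α E : Type*) (R : Type*) [Fintype α] [DecidableEq α] [CommRing R]
    [AddCommGroup E] : ((α → R) × (Finset α → R) × E) ≃ ((α → R) × (Finset α → R) × E) where
  toFun x := (x.1, x.2.1 + (fun I => ∏ i ∈ Iᶜ, x.1 i), x.2.2)
  invFun x := (x.1, x.2.1 - (fun I => ∏ i ∈ Iᶜ, x.1 i), x.2.2)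
  left_inv x := by simp
  right_inv x := by simp

theorem monomialShear_mem_indicatorConnectionSet_iff {p : ℕ} [Fact p.Prime] [CharP R p]
    (hα : Fintype.card α = 2 * p - 1) (x y : (α → R) × (Finset α → R) × E) :
    -x + y ∈ indicatorConnectionSet α E (p - 1) (0 : R) ↔
      -monomialShear α E R x + monomialShear α E R y ∈
        indicatorConnectionSet α E (p - 1) (1 : R) := by
  have hJ : ∀ (x y : (α → R) × (Finset α → R) × E) (J : Finset α),
      -x + y ∈ indicatorFiber α E (p - 1) (0 : R) J ↔
        -monomialShear α E R x + monomialShear α E R y ∈ indicatorFiber α E (p - 1) (1 : R) J := by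
    rintro ⟨u, w, e⟩ ⟨u', w', e'⟩ J
    simp only [indicatorFiber, monomialShear, Set.mem_ofPred_eq, Equiv.coe_fn_mk, Prod.neg_mk,
      Prod.mk_add_mk]
    refine and_congr_right fun h => and_congr_left fun _ => ?_
    obtain rfl : u' = u + finsetIndicator R J := by rw [← h]; abel
    have h1 := sum_powersetCard_prod_compl_translate hα u J
    simp only [Pi.add_apply, Pi.neg_apply, Finset.sum_add_distrib, Finset.sum_neg_distrib,
      finsetIndicator, h1, ite_self]
    generalize (if J = Finset.univ then (1 : R) else 0) = r
    constructor <;> intro h2 <;> linear_combination h2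
  have h0 : (-x + y).1 = 0 ∧ -x + y ≠ 0 ↔
      (-monomialShear α E R x + monomialShear α E R y).1 = 0 ∧
        -monomialShear α E R x + monomialShear α E R y ≠ 0 := by
    refine and_congr Iff.rfl (not_congr ?_)
    rw [neg_add_eq_zero, neg_add_eq_zero, (monomialShear α E R).injective.eq_iff]
  have hswap : ∀ x y : (α → R) × (Finset α → R) × E, -(-x + y) = -y + x := fun x y => by abel
  refine or_congr h0 (or_congr ?_ ?_)
  · simp only [hJ]
  · simp only [hswap, hJ]

/-- The shear carries the graph with `c = 0` to the one with `c = 1`. An injective endomorphism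
doing so on connection sets would yield an additive map excluded by
`not_forall_sum_powersetCard_indicator`. -/
theorem IsCIGroup.not_injective_of_indicator {G : Type*} [Group G] (hG : IsCIGroup G) {p : ℕ}
    [Fact p.Prime] [Infinite E] (hα : Fintype.card α = 2 * p - 1)
    (f : Multiplicative ((α → ZMod p) × (Finset α → ZMod p) × E) →* G) :
    ¬ Function.Injective f := by
  intro hf
  have hp := (Fact.out : p.Prime).two_le
  obtain ⟨β, hβ, hβS⟩ := hG.exists_endomorphism f hf zero_notMem_indicatorConnectionSet
    (fun x => neg_mem_indicatorConnectionSet) zero_notMem_indicatorConnectionSet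
    (fun x => neg_mem_indicatorConnectionSet) closure_indicatorConnectionSet
    (monomialShear α E (ZMod p)) (monomialShear_mem_indicatorConnectionSet_iff hα)
  let W : AddSubgroup ((α → ZMod p) × (Finset α → ZMod p) × E) := (AddMonoidHom.fst _ _).ker
  have hW : ∀ x, x ∈ W ↔ x.1 = 0 := fun x => Iff.rfl
  have hWinf : (W : Set ((α → ZMod p) × (Finset α → ZMod p) × E)).Infinite := by
    refine (Set.infinite_range_of_injective (f := fun e : E =>
      ((0, 0, e) : (α → ZMod p) × (Finset α → ZMod p) × E)) fun a b h => ?_).mono ?_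
    · simpa using h
    · rintro _ ⟨e, rfl⟩
      rfl
  have hF : {x : (α → ZMod p) × (Finset α → ZMod p) × E | x.2.2 = 0}.Finite := by
    refine (Set.finite_range fun y : (α → ZMod p) × (Finset α → ZMod p) =>
      ((y.1, y.2, 0) : (α → ZMod p) × (Finset α → ZMod p) × E)).subset ?_
    rintro ⟨u, w, e⟩ h
    exact ⟨(u, w), by rw [show e = 0 from h]⟩
  -- Outside the infinite subgroup `W` both connection sets are finite, so `β` must preserve `W`.
  have hmap : W.map β = W := by
    apply le_antisymm
    · refine AddSubgroup.le_of_subset_union_finite ?_ hF ?_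
      · rw [AddSubgroup.coe_map]
        exact hWinf.image hβ.injOn
      · rintro _ ⟨x, hx, rfl⟩
        by_cases h0 : x = 0
        · left
          rw [h0, map_zero]
          exact W.zero_mem
        · by_cases h1 : (β x).1 = 0
          · exact Or.inl h1
          · have h2 : β x ∈ indicatorConnectionSet α E (p - 1) (1 : ZMod p) :=
              hβS ▸ ⟨x, Or.inl ⟨hx, h0⟩, rfl⟩
            exact Or.inr (snd_snd_eq_zero_of_mem_indicatorConnectionSet h2 h1)
    · refine AddSubgroup.le_of_subset_union_finite hWinf (hF.image β) ?_
      intro x hx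
      by_cases h0 : x = 0
      · left
        rw [h0]
        exact AddSubgroup.zero_mem _
      · have : x ∈ indicatorConnectionSet α E (p - 1) (1 : ZMod p) := Or.inl ⟨hx, h0⟩
        rw [← hβS] at this
        obtain ⟨s, hs, rfl⟩ := this
        by_cases h1 : s.1 = 0
        · exact Or.inl ⟨s, h1, rfl⟩
        · exact Or.inr ⟨s, snd_snd_eq_zero_of_mem_indicatorConnectionSet hs h1, rfl⟩
  have hβW : ∀ x, (β x).1 = 0 ↔ x.1 = 0 := by
    intro x
    rw [← hW, ← hW]
    nth_rewrite 1 [← hmap]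
    exact AddSubgroup.mem_map_iff_mem hβ
  let ι := AddMonoidHom.inl (α → ZMod p) ((Finset α → ZMod p) × E)
  let b : (α → ZMod p) →+ (α → ZMod p) := (AddMonoidHom.fst _ _).comp (β.comp ι)
  have hb : Function.Injective b := by
    rw [injective_iff_map_eq_zero]
    intro u hu
    exact (hβW (u, 0)).1 hu
  let b' := AddEquiv.ofBijective b (Finite.injective_iff_bijective.1 hb)
  -- `b` is the map induced by `β` modulo `W`; `l` reads off the middle component of `β` after
  -- undoing `b`.
  let l : (α → ZMod p) →+ (Finset α → ZMod p) :=
    ((AddMonoidHom.fst _ _).comp (AddMonoidHom.snd _ _)).comp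
      (β.comp (ι.comp b'.symm.toAddMonoidHom))
  refine not_forall_sum_powersetCard_indicator (q := p - 1) (by omega) (by omega) l ?_
  intro J hJ
  have h0 : ((finsetIndicator (ZMod p) J, 0, 0) : (α → ZMod p) × (Finset α → ZMod p) × E) ∈
      indicatorConnectionSet α E (p - 1) (0 : ZMod p) :=
    Or.inr (Or.inl ⟨J, hJ, rfl, by simp, rfl⟩)
  have h1 := (monomialShear_mem_indicatorConnectionSet_iff hα 0
    ((finsetIndicator (ZMod p) J, 0, 0) : (α → ZMod p) × (Finset α → ZMod p) × E)).1
    (by simpa using h0)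
  rw [← hβS] at h1
  obtain ⟨s, hs, hsJ⟩ := h1
  have hsJ' : (β s).1 = finsetIndicator (ZMod p) J := by
    rw [hsJ]
    simp [monomialShear]
  have hs0 : s.1 ≠ 0 := by
    rw [Ne, ← hβW, hsJ']
    exact finsetIndicator_ne_zero hJ
  have hbs : b s.1 = finsetIndicator (ZMod p) J := by
    rw [← hsJ', ← sub_eq_zero]
    have h2 : b s.1 - (β s).1 = (β ((s.1, 0) - s)).1 := by
      rw [map_sub]; rfl
    rw [h2, hβW]
    simp
  have hl : l (finsetIndicator (ZMod p) J) = (β (s.1, 0, 0)).2.1 := by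
    have : b'.symm (finsetIndicator (ZMod p) J) = s.1 := by
      rw [AddEquiv.symm_apply_eq]
      exact hbs.symm
    change (β (ι (b'.symm _))).2.1 = _
    rw [this]
    rfl
  have hmem : β (s.1, 0, 0) ∈ indicatorConnectionSet α E (p - 1) (1 : ZMod p) :=
    hβS ▸ ⟨_, mk_fst_zero_mem_indicatorConnectionSet hs hs0, rfl⟩
  have := sum_powersetCard_of_mem_indicatorConnectionSet hmem hJ hbs
  rw [← hl] at this
  exact this

end Elementary

theorem IsCIGroup.finite_setOf_pow_prime_eq_one {G : Type*} [CommGroup G] (hG : IsCIGroup G)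
    {p : ℕ} (hp : p.Prime) : {x : G | x ^ p = 1}.Finite := by
  have : Fact p.Prime := ⟨hp⟩
  by_contra hinf
  let M : Subgroup G := (powMonoidHom p : G →* G).ker
  have : Infinite (Additive M) := Set.infinite_coe_iff.2 hinf
  let : Module (ZMod p) (Additive M) := AddCommGroup.zmodModule (n := p) fun x =>
    Additive.toMul.injective (Subtype.ext x.toMul.2)
  have hrank : Cardinal.aleph0 ≤ Module.rank (ZMod p) (Additive M) := by
    by_contra! h
    have := Module.rank_lt_aleph0_iff.1 h
    exact not_finite_iff_infinite.2 ‹_› (Module.finite_of_finite (ZMod p))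
  let V := (Fin (2 * p - 1) → ZMod p) × (Finset (Fin (2 * p - 1)) → ZMod p) × (ℕ →₀ ZMod p)
  have hV : Module.rank (ZMod p) V ≤ Cardinal.aleph0 :=
    (Module.Basis.ofVectorSpace (ZMod p) V).mk_eq_rank''.symm.le.trans
      (Cardinal.mk_le_aleph0_iff.2 inferInstance)
  obtain ⟨f, hf⟩ := (lift_rank_le_iff_exists_linearMap (R := ZMod p) (M := V)
    (M' := Additive M)).1 (by
      refine (Cardinal.lift_le.2 hV).trans ?_
      rw [Cardinal.lift_aleph0]
      simpa using hrank)
  refine hG.not_injective_of_indicator (α := Fin (2 * p - 1)) (E := ℕ →₀ ZMod p) (p := p)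
    (by simp) (M.subtype.comp (AddMonoidHom.toMultiplicativeLeft f.toAddMonoidHom)) ?_
  exact M.subtype_injective.comp fun a b h => hf h

/-! ### Bounded torsion and primes of element orders -/

theorem finite_setOf_pow_eq_one {G : Type*} [CommGroup G]
    (h : ∀ p : ℕ, p.Prime → {x : G | x ^ p = 1}.Finite) {N : ℕ} (hN : N ≠ 0) :
    {x : G | x ^ N = 1}.Finite := by
  induction N using induction_on_primes with
  | zero => exact absurd rfl hN
  | one => simp
  | prime_mul p a hp ih =>
    have h1 : {x : G | x ^ (p * a) = 1} = (fun x => x ^ p) ⁻¹' {x : G | x ^ a = 1} := by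
      ext x
      simp [pow_mul]
    rw [h1]
    refine (ih (right_ne_zero_of_mul hN)).preimage' fun y _ => ?_
    rcases ((fun x : G => x ^ p) ⁻¹' {y}).eq_empty_or_nonempty with he | ⟨z, hz⟩
    · rw [he]
      exact Set.finite_empty
    · refine ((h p hp).image (fun x => z * x)).subset fun x hx => ⟨z⁻¹ * x, ?_, by simp⟩
      simp only [Set.mem_preimage, Set.mem_singleton_iff, Set.mem_ofPred_eq] at hx hz ⊢
      rw [mul_pow, inv_pow, hx, hz, inv_mul_cancel]

/-- The elements of a commutative group whose order has all its prime factors in `Q`. -/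
def primaryPart (G : Type*) [CommGroup G] (Q : Set ℕ) :
    Subgroup G where
  carrier := {x | ∀ p, p.Prime → p ∣ orderOf x → p ∈ Q}
  one_mem' p hp h := by
    rw [orderOf_one] at h
    exact absurd (Nat.dvd_one.1 h) hp.ne_one
  mul_mem' {x y} hx hy p hp h := by
    have h1 : p ∣ orderOf x * orderOf y :=
      h.trans ((Commute.all x y).orderOf_mul_dvd_mul_orderOf)
    rcases hp.dvd_mul.1 h1 with h2 | h2
    · exact hx p hp h2
    · exact hy p hp h2
  inv_mem' {x} hx p hp h := hx p hp (by rwa [orderOf_inv] at h)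

theorem infinite_quotient_of_disjoint {G : Type*} [Group G] {H K : Subgroup G} [Infinite K]
    (h : Disjoint H K) : Infinite (G ⧸ H) := by
  refine Infinite.of_injective (fun x : K => (QuotientGroup.mk (x : G) : G ⧸ H)) fun x y hxy => ?_
  rw [QuotientGroup.eq] at hxy
  have := Subgroup.disjoint_def.1 h hxy (K.mul_mem (K.inv_mem x.2) y.2)
  exact Subtype.ext (inv_mul_eq_one.1 this)

/-- In a countable CI-group, two infinite subgroups of infinite index are related by an
automorphism. -/
theorem IsCIGroup.exists_mulEquiv_map_eq {G : Type*} [Group G] [Countable G] (hG : IsCIGroup G)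
    (H K : Subgroup G) [Infinite H] [Infinite K] [Infinite (G ⧸ H)] [Infinite (G ⧸ K)] :
    ∃ α : G ≃* G, ∀ x, α x ∈ K ↔ x ∈ H := by
  have conn : ∀ L : Subgroup G, IsConnectionSet ((L : Set G) \ {1}) := fun L =>
    ⟨fun h => h.2 rfl, by ext x; simp⟩
  have : Countable (G ⧸ H) := Quotient.countable
  have : Countable (G ⧸ K) := Quotient.countable
  -- Both graphs are countably many disjoint copies of the countably infinite complete graph.
  obtain ⟨q⟩ := nonempty_equiv_of_countable (α := G ⧸ H) (β := G ⧸ K)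
  obtain ⟨φ⟩ := nonempty_equiv_of_countable (α := H) (β := K)
  obtain ⟨α, hα⟩ := hG.exists_mulEquiv_of_subgroup q φ (conn H) (conn K) Set.sdiff_subset
    Set.sdiff_subset (by
      intro x y
      have h (L : Subgroup G) (x y : L) : (x : G)⁻¹ * y ∈ (L : Set G) \ {1} ↔ x ≠ y := by
        rw [Set.mem_sdiff, Set.mem_singleton_iff, inv_mul_eq_one, Subtype.coe_inj]
        exact and_iff_right (L.mul_mem (L.inv_mem x.2) y.2)
      rw [h, h, φ.injective.ne_iff])
  refine ⟨α, fun x => ?_⟩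
  by_cases hx : x = 1
  · simp [hx, H.one_mem, K.one_mem]
  · have h1 : α x ∈ (K : Set G) \ {1} ↔ x ∈ (H : Set G) \ {1} := by
      rw [← hα, α.injective.mem_set_image]
    simpa [hx] using h1

/-- In a countable commutative CI-group, only finitely many primes occur as orders of elements. -/
theorem IsCIGroup.finite_setOf_prime_orderOf {G : Type*} [CommGroup G] [Countable G]
    (hG : IsCIGroup G) :
    {p : ℕ | p.Prime ∧ ∃ x : G, orderOf x = p}.Finite := by
  by_contra hinf
  obtain ⟨P, Q, hPQ, hdisj, hcard⟩ :=
    Set.Infinite.exists_union_disjoint_cardinal_eq_of_infinite hinf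
  have hPinf : P.Infinite := by
    intro hP
    have hQ : Q.Finite := by
      rw [← Cardinal.lt_aleph0_iff_set_finite] at hP ⊢
      rwa [← hcard]
    exact hinf (hPQ ▸ hP.union hQ)
  have hQinf : Q.Infinite := by
    intro hQ
    apply hPinf
    rw [← Cardinal.lt_aleph0_iff_set_finite] at hQ ⊢
    rwa [hcard]
  have hord : ∀ {T : Set ℕ}, T ⊆ P ∪ Q → ∀ p ∈ T, p.Prime ∧ ∃ x : G, orderOf x = p :=
    fun hT p hp => hPQ.subset (hT hp)
  have hInf : ∀ T : Set ℕ, T.Infinite → T ⊆ P ∪ Q → Infinite (primaryPart G T) := by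
    intro T hT hsub
    have := hT.to_subtype
    choose g hg using fun p : T => (hord hsub p p.2).2
    refine Infinite.of_injective (fun p : T => (⟨g p, fun r hr h => ?_⟩ : primaryPart G T)) ?_
    · rw [hg, Nat.prime_dvd_prime_iff_eq hr (hord hsub p p.2).1] at h
      exact h ▸ p.2
    · intro p r h
      have := congrArg (fun x : primaryPart G T => orderOf (x : G)) h
      simp only [hg] at this
      exact Subtype.ext this
  have i1 := hInf P hPinf Set.subset_union_left
  have i2 := hInf Q hQinf Set.subset_union_right
  have hd : Disjoint (primaryPart G P) (primaryPart G Q) := by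
    rw [Subgroup.disjoint_def]
    intro x hx hy
    by_contra hne
    obtain ⟨r, hr, hrx⟩ := Nat.exists_prime_and_dvd (mt orderOf_eq_one_iff.1 hne)
    exact Set.disjoint_left.1 hdisj (hx r hr hrx) (hy r hr hrx)
  have i3 := infinite_quotient_of_disjoint hd
  have i4 := infinite_quotient_of_disjoint hd.symm
  obtain ⟨α, hα⟩ := hG.exists_mulEquiv_map_eq (primaryPart G P) (primaryPart G Q)
  obtain ⟨⟨x, hx⟩, hx1⟩ := exists_ne (1 : primaryPart G P)
  refine hx1 (Subtype.ext (Subgroup.disjoint_def.1 hd hx fun r hr h => ?_))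
  exact (hα x).2 hx r hr (by rwa [MulEquiv.orderOf_eq])

theorem mainTheorem3 (G : Type*) [CommGroup G] [Infinite G] : ¬ IsCIGroup G := by
  intro hG
  have hsix : ∀ (x : G) (p : ℕ), p.Prime → ¬ p ^ 6 ∣ orderOf x := fun x p hp =>
    hG.not_prime_pow_six_dvd_orderOf hp x
  -- Infinite order is encoded as `0`, which `2 ^ 6` divides.
  have htor : ∀ x : G, orderOf x ≠ 0 := fun x h => hsix x 2 Nat.prime_two (h ▸ dvd_zero _)
  have hfin : ∀ {N : ℕ}, N ≠ 0 → {x : G | x ^ N = 1}.Finite :=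
    finite_setOf_pow_eq_one fun p hp => hG.finite_setOf_pow_prime_eq_one hp
  have hcount : Countable G := by
    rw [← Set.countable_univ_iff]
    refine (Set.countable_iUnion fun N : ℕ => (hfin N.succ_ne_zero).countable).mono fun x _ => ?_
    refine Set.mem_iUnion.2 ⟨orderOf x - 1, ?_⟩
    rw [Nat.succ_eq_add_one, Nat.sub_add_cancel (Nat.one_le_iff_ne_zero.2 (htor x))]
    exact pow_orderOf_eq_one x
  have hP := hG.finite_setOf_prime_orderOf
  have hN : ∏ p ∈ hP.toFinset, p ^ 6 ≠ 0 :=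
    Finset.prod_ne_zero_iff.2 fun p hp => pow_ne_zero _ (hP.mem_toFinset.1 hp).1.ne_zero
  refine Set.infinite_univ (α := G) ((hfin hN).subset fun x _ => ?_)
  refine orderOf_dvd_iff_pow_eq_one.1 ?_
  rw [← Nat.prod_factorization_pow_eq_self (htor x)]
  have hsub : (orderOf x).primeFactors ⊆ hP.toFinset := by
    intro p hp
    refine hP.mem_toFinset.2 ⟨Nat.prime_of_mem_primeFactors hp, x ^ (orderOf x / p), ?_⟩
    exact orderOf_pow_orderOf_div (htor x) (Nat.dvd_of_mem_primeFactors hp)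
  refine (Finset.prod_dvd_prod_of_dvd _ _ fun p hp => pow_dvd_pow p ?_).trans
    (Finset.prod_dvd_prod_of_subset _ _ (fun p => p ^ 6) hsub)
  by_contra! h
  exact hsix x p (Nat.prime_of_mem_primeFactors hp)
    ((pow_dvd_pow p h.le).trans (Nat.ordProj_dvd _ _))
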